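/- Let $\mu$ be the infinitely divisible distribution $ID(A,L,b)_h$ on $\mathbb R^d$, i.e. the probability measure with characteristic function $$\exp\Big\{-\tfrac12\langle z,Az\rangle+i\langle b,z\rangle+\int_{\mathbb R^d}\big(e^{i\langle z,x\rangle}-1-i\langle z,x\rangle h(x)\big)\,L(dx)\Big\},\qquad z\in\mathbb R^d,$$ where $A$ is a symmetric nonnegative-definite $d\times d$ matrix, $b\in\mathbb R^d$, $L$ is a Borel measure with $L(\{0\})=0$ and $\int(|x|^2\wedge1)\,L(dx)<\infty$, and $h:\mathbb R^d\to\mathbb R$ is a Borel function for which the integrand is $L$-integrable for every $z$. Let $g:\mathbb R^d\to[0,\infty)$ be a Borel function such that (A1) $0\le g(x)\le1$ for all $x\in\mathbb R^d$, and (A2) $\int_{\mathbb R^d}(|x h(x)|\vee1)(1-g(x))\,L(dx)<\infty$. Put $\tilde L(dx)=g(x)L(dx)$, $\tilde b=b-\int_{\mathbb R^d}x h(x)(1-g(x))\,L(dx)$, $\tilde\mu=ID(A,\tilde L,\tilde b)_h$, $\rho(dx)=(1-g(x))L(dx)$ and $\eta=\rho(\mathbb R^d)$. Let $V_t=\sum_{i=1}^{N_t}Z_i$,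 $t\ge0$, where $N=\{N_t:t\ge0\}$ is a Poisson process with intensity $\eta$ and, independently of $N$, the $Z_i$ are iid with distribution $\rho/\eta$ (if $\eta=0$, then $N=0$ almost surely and the distribution of the $Z_i$ is arbitrary). Let $T=\inf\{t\ge0:N_t>0\}$, with $\inf\emptyset=\infty$. Let $\tilde X=\{\tilde X_t:t\ge0\}$ be a Lévy process (that is, $\tilde X_0=0$ almost surely, and $\tilde X$ is stochastically continuous with independent and stationary increments), independent of $V$, with $\tilde X_1\sim\tilde\mu$, and set $X_t=\tilde X_t+V_t$ for $t\ge0$. Then $\eta<\infty$, $P(T>t)=e^{-t\eta}$ for all $t\ge0$ (so $T$ is exponentially distributed with rate $\eta$ if $\eta>0$), and the following hold. 1. The process $X=\{X_t:t\ge0\}$ is a Lévy process with $X_1\sim\mu$. If moreover the paths of $\tilde X$ are almost surely càdlàg, then so are those of $X$. 2. If $0\le t<T$, then $X_t=\tilde X_t$. 3. For every Borel set $B\subseteq\mathbb R^d$ and every $t\ge0$, $P(\tilde X_t\in B)\le e^{t\eta}P(X_t\in B)$. -/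

import Mathlib

open MeasureTheory ProbabilityTheory Filter Topology
open scoped NNReal ENNReal

noncomputable section

/-! ### Infinitely divisible distributions -/

/-- `L` is a Lévy measure on `ℝ^d`: `L({0}) = 0` and `∫ (|x|² ∧ 1) L(dx) < ∞`. -/
structure IsLevyMeasure {d : ℕ} (L : Measure (EuclideanSpace ℝ (Fin d))) : Prop where
  zero : L {0} = 0
  lintegral_lt_top : ∫⁻ x, ENNReal.ofReal (min (‖x‖ ^ 2) 1) ∂L < ∞

/-- The integrand `e^{i⟨z,x⟩} - 1 - i⟨z,x⟩h(x)` of the Lévy–Khintchine formula. -/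
def levyIntegrand {d : ℕ} (h : EuclideanSpace ℝ (Fin d) → ℝ)
    (z x : EuclideanSpace ℝ (Fin d)) : ℂ :=
  Complex.exp (Complex.I * ((inner ℝ z x : ℝ) : ℂ)) - 1
    - Complex.I * ((inner ℝ z x : ℝ) : ℂ) * ((h x : ℝ) : ℂ)

/-- The exponent
`C(z) = -⟨z,Az⟩/2 + i⟨b,z⟩ + ∫ (e^{i⟨z,x⟩} - 1 - i⟨z,x⟩h(x)) L(dx)`. -/
def levyExponent {d : ℕ} (A : Matrix (Fin d) (Fin d) ℝ)
    (L : Measure (EuclideanSpace ℝ (Fin d))) (b : EuclideanSpace ℝ (Fin d))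
    (h : EuclideanSpace ℝ (Fin d) → ℝ) (z : EuclideanSpace ℝ (Fin d)) : ℂ :=
  -(1 / 2 : ℂ) * ((z.ofLp ⬝ᵥ A.mulVec z.ofLp : ℝ) : ℂ)
    + Complex.I * ((inner ℝ b z : ℝ) : ℂ)
    + ∫ x, levyIntegrand h z x ∂L

/-- `μ = ID(A, L, b)_h`: `A` is symmetric nonnegative-definite, `L` is a Lévy measure, `h` is a
Borel function for which the Lévy–Khintchine integrand is `L`-integrable at every `z`, and `μ` is
the probability measure with characteristic function `exp C(z)`. -/
structure IsID {d : ℕ} (μ : Measure (EuclideanSpace ℝ (Fin d)))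
    (A : Matrix (Fin d) (Fin d) ℝ) (L : Measure (EuclideanSpace ℝ (Fin d)))
    (b : EuclideanSpace ℝ (Fin d)) (h : EuclideanSpace ℝ (Fin d) → ℝ) : Prop where
  posSemidef : A.PosSemidef
  isLevyMeasure : IsLevyMeasure L
  measurable_h : Measurable h
  integrable : ∀ z, Integrable (levyIntegrand h z) L
  isProbabilityMeasure : IsProbabilityMeasure μ
  charFun_eq : ∀ z, charFun μ z = Complex.exp (levyExponent A L b h z)

/-! ### Lévy processes -/

/-- A path is càdlàg: right-continuous with left limits. -/
def IsCadlagPath {E : Type*} [TopologicalSpace E] (f : ℝ≥0 → E) : Prop :=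
  ∀ t, ContinuousWithinAt f (Set.Ici t) t ∧ ∃ l, Tendsto f (𝓝[<] t) (𝓝 l)

/-- A Lévy process, without path regularity: `X₀ = 0` almost surely, the increments are
independent and stationary, and the process is stochastically continuous. -/
structure IsLevyProcessInLaw {d : ℕ} {Ω : Type*} [MeasurableSpace Ω]
    (X : ℝ≥0 → Ω → EuclideanSpace ℝ (Fin d)) (P : Measure Ω) : Prop where
  measurable : ∀ t, Measurable (X t)
  start : ∀ᵐ ω ∂P, X 0 ω = 0
  indep : HasIndepIncrements X P
  stationary : ∀ s t : ℝ≥0,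
    P.map (fun ω ↦ X (s + t) ω - X s ω) = P.map (fun ω ↦ X t ω - X 0 ω)
  stochCont : ∀ t, TendstoInMeasure P X (𝓝 t) (X t)

/-- A Lévy process with almost surely càdlàg paths. -/
structure IsLevyProcess {d : ℕ} {Ω : Type*} [MeasurableSpace Ω]
    (X : ℝ≥0 → Ω → EuclideanSpace ℝ (Fin d)) (P : Measure Ω) : Prop
    extends IsLevyProcessInLaw X P where
  cadlag : ∀ᵐ ω ∂P, IsCadlagPath (fun t ↦ X t ω)

/-! ### Compound Poisson processes -/

/-- `N` is a Poisson process with intensity `r ≥ 0`: it starts at `0`, its increments are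
independent, `N (s + t) - N s` has the Poisson distribution with parameter `r * t`, and its paths
are almost surely nondecreasing and right-continuous. Increments are taken in `ℤ`, where
subtraction does not truncate. -/
structure IsPoissonProcess {Ω : Type*} [MeasurableSpace Ω]
    (N : ℝ≥0 → Ω → ℕ) (r : ℝ≥0) (P : Measure Ω) : Prop where
  measurable : ∀ t, Measurable (N t)
  start : ∀ᵐ ω ∂P, N 0 ω = 0
  indep : HasIndepIncrements (fun t ω ↦ (N t ω : ℤ)) P
  law : ∀ s t : ℝ≥0, P.map (fun ω ↦ (N (s + t) ω : ℤ) - (N s ω : ℤ))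
    = (poissonMeasure (r * t)).map (fun n : ℕ ↦ (n : ℤ))
  path : ∀ᵐ ω ∂P, Monotone (fun t ↦ N t ω) ∧
    ∀ t, ContinuousWithinAt (fun s ↦ N s ω) (Set.Ici t) t

/-- `V t = Z 0 + ⋯ + Z (N t - 1)`, the sum of the first `N t` jumps. -/
def compoundSum {d : ℕ} {Ω : Type*} (N : ℝ≥0 → Ω → ℕ)
    (Z : ℕ → Ω → EuclideanSpace ℝ (Fin d)) (t : ℝ≥0) (ω : Ω) : EuclideanSpace ℝ (Fin d) :=
  ∑ i ∈ Finset.range (N t ω), Z i ω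

/-- `(N, Z)` are the data of a compound Poisson process with finite jump measure `ρ`: with
`η = ρ(ℝ^d)`, `N` is a Poisson process with intensity `η`, the `Z i` are iid with distribution
`ρ / η`, and the sequence `Z` is independent of the process `N`. If `η = 0` then `N` is almost
surely zero, and the common distribution of the `Z i`, which plays no role, is arbitrary. -/
structure IsCompoundPoissonData {d : ℕ} {Ω : Type*} [MeasurableSpace Ω]
    (N : ℝ≥0 → Ω → ℕ) (Z : ℕ → Ω → EuclideanSpace ℝ (Fin d))
    (ρ : Measure (EuclideanSpace ℝ (Fin d))) (P : Measure Ω) : Prop where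
  poisson : IsPoissonProcess N (ρ Set.univ).toNNReal P
  measurable : ∀ i, Measurable (Z i)
  iIndep : iIndepFun Z P
  identDistrib : ∀ i, P.map (Z i) = P.map (Z 0)
  law : ρ Set.univ ≠ 0 → ∀ i, P.map (Z i) = (ρ Set.univ)⁻¹ • ρ
  indep : IndepFun (fun ω i ↦ Z i ω) (fun ω t ↦ N t ω) P

/-- `T = inf {t ≥ 0 : N t > 0}`, with value `∞` if there is no such `t`. -/
def firstJumpTime {Ω : Type*} (N : ℝ≥0 → Ω → ℕ) (ω : Ω) : ℝ≥0∞ :=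
  sInf {s : ℝ≥0∞ | ∃ t : ℝ≥0, 0 < N t ω ∧ s = t}

/-! ### Tempering -/

/-- The tempered Lévy measure `L̃(dx) = g(x) L(dx)`. -/
def temperedMeasure {d : ℕ} (L : Measure (EuclideanSpace ℝ (Fin d)))
    (g : EuclideanSpace ℝ (Fin d) → ℝ) : Measure (EuclideanSpace ℝ (Fin d)) :=
  L.withDensity (fun x ↦ ENNReal.ofReal (g x))

/-- The measure `ρ(dx) = (1 - g(x)) L(dx)` of removed jumps. -/
def removedMeasure {d : ℕ} (L : Measure (EuclideanSpace ℝ (Fin d)))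
    (g : EuclideanSpace ℝ (Fin d) → ℝ) : Measure (EuclideanSpace ℝ (Fin d)) :=
  L.withDensity (fun x ↦ ENNReal.ofReal (1 - g x))

/-- The tempered shift `b̃ = b - ∫ x h(x) (1 - g(x)) L(dx)`. -/
def temperedShift {d : ℕ} (L : Measure (EuclideanSpace ℝ (Fin d)))
    (b : EuclideanSpace ℝ (Fin d)) (h g : EuclideanSpace ℝ (Fin d) → ℝ) :
    EuclideanSpace ℝ (Fin d) :=
  b - ∫ x, (h x * (1 - g x)) • x ∂L

end

/-! Since `L = g L + (1 - g) L`, the Lévy integrand splits into its `g`-part and its `(1 - g)`-part.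
By (A2) the latter separates further into two convergent integrals: the compensator, which is
absorbed into the shift `b̃`, and `∫ (e^{i⟨z,x⟩} - 1) dρ`, the exponent of a compound Poisson law
with finite jump measure `ρ`. This is `levyExponent_eq_tempered_add`; with
`IsCompoundPoissonData.charFun_one` and independence it gives `X 1` the characteristic function of
`μ`.

That `X` is a Lévy process rests on the joint characteristic function of the increments of `V`,
found by conditioning on `N` (`IsCompoundPoissonData.integral_exp_increments`). Stochastic
continuity and path regularity of `V` come from those of `N`.

Before `T` the sum `V` is empty, so `X` and `X̃` agree. As `V t = 0` has probability at least
`e^{-tη}` and is independent of `X̃`, restricting to this event yields the comparison of laws. -/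

/-- The sum of two independent processes with independent increments has independent increments. -/
lemma hasIndepIncrements_add {d : ℕ} {Ω : Type*} [MeasurableSpace Ω] {P : Measure Ω}
    {X Y : ℝ≥0 → Ω → EuclideanSpace ℝ (Fin d)}
    (hXm : ∀ t, Measurable (X t)) (hYm : ∀ t, Measurable (Y t))
    (hX : HasIndepIncrements X P) (hY : HasIndepIncrements Y P)
    (hXY : IndepFun (fun ω t ↦ X t ω) (fun ω t ↦ Y t ω) P) :
    HasIndepIncrements (fun t ω ↦ X t ω + Y t ω) P := by
  intro n t ht
  have h1 := hX n t ht
  have h2 := hY n t ht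
  have := h1.isProbabilityMeasure
  -- Independence of increments means that their joint characteristic function factorises, and for
  -- independent `X` and `Y` these factorisations multiply.
  rw [iIndepFun_iff_charFun_pi (fun i ↦ by fun_prop)] at h1 h2 ⊢
  intro z
  have hinc : IndepFun
      (fun ω ↦ WithLp.toLp 2 fun i : Fin n ↦ X (t i.succ) ω - X (t i.castSucc) ω)
      (fun ω ↦ WithLp.toLp 2 fun i : Fin n ↦ Y (t i.succ) ω - Y (t i.castSucc) ω) P :=
    hXY.comp
      (φ := fun f ↦ WithLp.toLp 2 fun i : Fin n ↦ f (t i.succ) - f (t i.castSucc))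
      (ψ := fun f ↦ WithLp.toLp 2 fun i : Fin n ↦ f (t i.succ) - f (t i.castSucc))
      (by fun_prop) (by fun_prop)
  have key := hinc.charFun_map_fun_add_eq_mul (by fun_prop) (by fun_prop)
  have hL : (fun ω ↦ WithLp.toLp 2 fun i : Fin n ↦
      (X (t i.succ) ω + Y (t i.succ) ω) - (X (t i.castSucc) ω + Y (t i.castSucc) ω))
      = fun ω ↦ WithLp.toLp 2 (fun i : Fin n ↦ X (t i.succ) ω - X (t i.castSucc) ω)
        + WithLp.toLp 2 (fun i : Fin n ↦ Y (t i.succ) ω - Y (t i.castSucc) ω) := by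
    funext ω
    rw [← WithLp.toLp_add]
    congr 1
    funext i
    exact add_sub_add_comm _ _ _ _
  rw [hL, key, Pi.mul_apply, h1, h2, ← Finset.prod_mul_distrib]
  refine Finset.prod_congr rfl fun i _ ↦ ?_
  have hi : IndepFun (fun ω ↦ X (t i.succ) ω - X (t i.castSucc) ω)
      (fun ω ↦ Y (t i.succ) ω - Y (t i.castSucc) ω) P :=
    hXY.comp (φ := fun f : ℝ≥0 → EuclideanSpace ℝ (Fin d) ↦ f (t i.succ) - f (t i.castSucc))
      (ψ := fun f : ℝ≥0 → EuclideanSpace ℝ (Fin d) ↦ f (t i.succ) - f (t i.castSucc))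
      (by fun_prop) (by fun_prop)
  rw [← Pi.mul_apply, ← hi.charFun_map_fun_add_eq_mul (by fun_prop) (by fun_prop)]
  congr 3
  funext ω
  exact (add_sub_add_comm (X _ ω) (Y _ ω) (X _ ω) (Y _ ω)).symm

/-- The Poisson generating function. -/
lemma integral_pow_poissonMeasure (r : ℝ≥0) (c : ℂ) :
    ∫ n : ℕ, c ^ n ∂(poissonMeasure r) = Complex.exp (r * (c - 1)) := by
  rw [integral_poissonMeasure]
  have h : ∀ n : ℕ, (Real.exp (-r) * (r : ℝ) ^ n / (n.factorial : ℝ)) • c ^ n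
      = Complex.exp (-r) * ((r * c) ^ n / (n.factorial : ℂ)) := by
    intro n
    rw [Complex.real_smul]
    push_cast
    ring
  simp_rw [h]
  rw [tsum_mul_left, (NormedSpace.expSeries_div_hasSum_exp (r * c)).tsum_eq,
    ← Complex.exp_eq_exp_ℂ, ← Complex.exp_add]
  congr 1
  ring

/-- Sums of iid variables over consecutive blocks have a product characteristic function. -/
lemma integral_exp_block_sums {d : ℕ} {Ω : Type*} [MeasurableSpace Ω] {P : Measure Ω}
    {Z : ℕ → Ω → EuclideanSpace ℝ (Fin d)} (hZm : ∀ i, Measurable (Z i)) (hZ : iIndepFun Z P)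
    (hid : ∀ i, P.map (Z i) = P.map (Z 0)) {n : ℕ} {m : Fin (n + 1) → ℕ} (hm : Monotone m)
    (z : Fin n → EuclideanSpace ℝ (Fin d)) :
    ∫ ω, ∏ j : Fin n, Complex.exp ((inner ℝ (∑ k ∈ Finset.range (m j.succ), Z k ω
        - ∑ k ∈ Finset.range (m j.castSucc), Z k ω) (z j) : ℝ) * Complex.I) ∂P
      = ∏ j : Fin n, charFun (P.map (Z 0)) (z j) ^ (m j.succ - m j.castSucc) := by
  have hle : ∀ j : Fin n, m j.castSucc ≤ m j.succ := fun j ↦ hm j.castSucc_lt_succ.le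
  have hsub : ∀ (j : Fin n) ω, ∑ k ∈ Finset.range (m j.succ), Z k ω
      - ∑ k ∈ Finset.range (m j.castSucc), Z k ω
      = ∑ k ∈ Finset.Ico (m j.castSucc) (m j.succ), Z k ω := fun j ω ↦
    (Finset.sum_Ico_eq_sub _ (hle j)).symm
  simp_rw [hsub]
  -- Different blocks are disjoint, so all pairs (block, index) label distinct, hence independent,
  -- members of `Z`.
  have hinj : Function.Injective
      (fun p : Σ j : Fin n, Finset.Ico (m j.castSucc) (m j.succ) ↦ (p.2 : ℕ)) := by
    rintro ⟨i, k, hki⟩ ⟨j, l, hkj⟩ hkl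
    obtain rfl : k = l := hkl
    rw [Finset.mem_Ico] at hki hkj
    obtain rfl : i = j := by
      by_contra hij
      rcases lt_or_gt_of_ne hij with h | h
      · have := hm (show i.succ ≤ j.castSucc from h)
        omega
      · have := hm (show j.succ ≤ i.castSucc from h)
        omega
    rfl
  have hprob := hZ.isProbabilityMeasure
  have key := (hZ.precomp hinj).integral_fun_prod_comp
    (f := fun p x ↦ Complex.exp ((inner ℝ x (z p.1) : ℝ) * Complex.I))
    (fun p ↦ (hZm _).aemeasurable) (fun p ↦ by fun_prop)
  simp only [Fintype.prod_sigma] at key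
  have hexp : ∀ (j : Fin n) ω, Complex.exp ((inner ℝ (∑ k ∈ Finset.Ico (m j.castSucc) (m j.succ),
      Z k ω) (z j) : ℝ) * Complex.I)
      = ∏ k : Finset.Ico (m j.castSucc) (m j.succ),
        Complex.exp ((inner ℝ (Z k ω) (z j) : ℝ) * Complex.I) := by
    intro j ω
    rw [← Complex.exp_sum, ← Finset.sum_mul, sum_inner, Complex.ofReal_sum, Finset.sum_coe_sort _
      (fun k ↦ ((inner ℝ (Z k ω) (z j) : ℝ) : ℂ))]
  simp_rw [hexp]
  rw [key]
  refine Finset.prod_congr rfl fun j _ ↦ ?_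
  have hphi : ∀ k, ∫ ω, Complex.exp ((inner ℝ (Z k ω) (z j) : ℝ) * Complex.I) ∂P
      = charFun (P.map (Z 0)) (z j) := by
    intro k
    rw [← hid k, charFun_apply, integral_map (by fun_prop) (by fun_prop)]
  simp [hphi]

/-! ### Compound Poisson processes: increments and characteristic functions -/

section compoundPoisson

variable {d : ℕ} {Ω : Type*} [MeasurableSpace Ω] {P : Measure Ω}
  {N : ℝ≥0 → Ω → ℕ} {Z : ℕ → Ω → EuclideanSpace ℝ (Fin d)}
  {ρ : Measure (EuclideanSpace ℝ (Fin d))}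

lemma measurable_compoundSum (hN : ∀ t, Measurable (N t)) (hZ : ∀ i, Measurable (Z i)) (t : ℝ≥0) :
    Measurable (compoundSum N Z t) := by
  have : Measurable fun p : ℕ × Ω ↦ ∑ i ∈ Finset.range p.1, Z i p.2 :=
    measurable_from_prod_countable_right fun n ↦
      Finset.measurable_fun_sum (Finset.range n) fun i _ ↦ hZ i
  exact this.comp ((hN t).prodMk measurable_id)

/-- Conditioning on the counting process: the jumps enter only through their common
characteristic function. -/
lemma IsCompoundPoissonData.integral_exp_increments [IsProbabilityMeasure P]
    (hV : IsCompoundPoissonData N Z ρ P) {n : ℕ} {t : Fin (n + 1) → ℝ≥0} (ht : Monotone t)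
    (z : Fin n → EuclideanSpace ℝ (Fin d)) :
    ∫ ω, ∏ j : Fin n, Complex.exp ((inner ℝ (compoundSum N Z (t j.succ) ω
        - compoundSum N Z (t j.castSucc) ω) (z j) : ℝ) * Complex.I) ∂P
      = ∫ ω, ∏ j : Fin n, charFun (P.map (Z 0)) (z j) ^ (N (t j.succ) ω - N (t j.castSucc) ω)
        ∂P := by
  have hNm := hV.poisson.measurable
  have hZm := hV.measurable
  -- Only finitely many counts matter. They live in a countable space, so measurability of `F` can
  -- be checked with the counts frozen.
  let M : Ω → Fin (n + 1) → ℕ := fun ω j ↦ N (t j) ω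
  have hM : Measurable M := by fun_prop
  let W : Ω → ℕ → EuclideanSpace ℝ (Fin d) := fun ω i ↦ Z i ω
  have hW : Measurable W := by fun_prop
  have hind : IndepFun W M P :=
    hV.indep.comp (φ := id) (ψ := fun (f : ℝ≥0 → ℕ) (j : Fin (n + 1)) ↦ f (t j)) measurable_id
      (by fun_prop)
  let F : (ℕ → EuclideanSpace ℝ (Fin d)) × (Fin (n + 1) → ℕ) → ℂ := fun p ↦
    ∏ j : Fin n, Complex.exp ((inner ℝ (∑ k ∈ Finset.range (p.2 j.succ), p.1 k
        - ∑ k ∈ Finset.range (p.2 j.castSucc), p.1 k) (z j) : ℝ) * Complex.I)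
  have hF : Measurable F := by
    refine measurable_from_prod_countable_left fun m ↦ ?_
    dsimp only [F]
    fun_prop
  have hFn : ∀ p, ‖F p‖ ≤ 1 := by
    intro p
    dsimp only [F]
    rw [norm_prod]
    refine Finset.prod_le_one (fun _ _ ↦ norm_nonneg _) fun j _ ↦ ?_
    rw [Complex.norm_exp_ofReal_mul_I]
  have hpW : IsProbabilityMeasure (P.map W) := Measure.isProbabilityMeasure_map hW.aemeasurable
  have hpM : IsProbabilityMeasure (P.map M) := Measure.isProbabilityMeasure_map hM.aemeasurable
  -- A difference of partial sums is a block sum only for nondecreasing counts, which holds almost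
  -- surely.
  have hmono : ∀ᵐ m ∂(P.map M), Monotone m := by
    rw [ae_map_iff hM.aemeasurable (Set.to_countable _).measurableSet]
    filter_upwards [hV.poisson.path] with ω hω
    exact fun i j hij ↦ hω.1 (ht hij)
  calc
    _ = ∫ ω, F (W ω, M ω) ∂P := rfl
    _ = ∫ p, F p ∂((P.map W).prod (P.map M)) := by
      rw [← hind.map_prod_eq_prod_map_map hW.aemeasurable hM.aemeasurable,
        integral_map (by fun_prop) hF.aestronglyMeasurable]
    _ = ∫ m, ∫ w, F (w, m) ∂(P.map W) ∂(P.map M) := by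
      rw [integral_prod_symm _ (Integrable.of_bound hF.aestronglyMeasurable 1 (ae_of_all _ hFn))]
    _ = ∫ m, ∏ j : Fin n, charFun (P.map (Z 0)) (z j) ^ (m j.succ - m j.castSucc)
          ∂(P.map M) := by
      refine integral_congr_ae ?_
      filter_upwards [hmono] with m hm
      have hFm : Measurable fun w ↦ F (w, m) := hF.comp (measurable_id.prodMk measurable_const)
      rw [integral_map hW.aemeasurable hFm.aestronglyMeasurable]
      exact integral_exp_block_sums hZm hV.iIndep hV.identDistrib hm z
    _ = _ := by
      rw [integral_map hM.aemeasurable .of_discrete]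

/-- The joint characteristic function of the increments of a compound Poisson process. -/
lemma IsCompoundPoissonData.integral_exp_increments_eq_prod [IsProbabilityMeasure P]
    (hV : IsCompoundPoissonData N Z ρ P) {n : ℕ} {t : Fin (n + 1) → ℝ≥0} (ht : Monotone t)
    (z : Fin n → EuclideanSpace ℝ (Fin d)) :
    ∫ ω, ∏ j : Fin n, Complex.exp ((inner ℝ (compoundSum N Z (t j.succ) ω
        - compoundSum N Z (t j.castSucc) ω) (z j) : ℝ) * Complex.I) ∂P
      = ∏ j : Fin n, Complex.exp (((ρ Set.univ).toNNReal * (t j.succ - t j.castSucc) : ℝ≥0)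
        * (charFun (P.map (Z 0)) (z j) - 1)) := by
  have hNm := hV.poisson.measurable
  rw [hV.integral_exp_increments ht]
  -- Independence is given for the `ℤ`-valued increments; `toNat` recovers the truncated difference
  -- in the exponent.
  have key := (hV.poisson.indep n t ht).integral_fun_prod_comp
    (f := fun j k ↦ charFun (P.map (Z 0)) (z j) ^ k.toNat) (fun j ↦ by fun_prop)
    (fun j ↦ .of_discrete)
  have hnat : ∀ (a b : ℕ), ((a : ℤ) - (b : ℤ)).toNat = a - b := by omega
  simp only [hnat] at key
  rw [key]
  refine Finset.prod_congr rfl fun j _ ↦ ?_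
  have hle : t j.castSucc ≤ t j.succ := ht j.castSucc_lt_succ.le
  have hlaw := hV.poisson.law (t j.castSucc) (t j.succ - t j.castSucc)
  rw [add_tsub_cancel_of_le hle] at hlaw
  have hint : ∫ ω, charFun (P.map (Z 0)) (z j) ^ (N (t j.succ) ω - N (t j.castSucc) ω) ∂P
      = ∫ k : ℤ, charFun (P.map (Z 0)) (z j) ^ k.toNat
        ∂(P.map fun ω ↦ (N (t j.succ) ω : ℤ) - (N (t j.castSucc) ω : ℤ)) := by
    rw [integral_map (by fun_prop) .of_discrete]
    simp only [hnat]
  rw [hint, hlaw, integral_map .of_discrete .of_discrete, ← integral_pow_poissonMeasure]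
  simp

lemma IsCompoundPoissonData.charFun_increment [IsProbabilityMeasure P]
    (hV : IsCompoundPoissonData N Z ρ P) {s t : ℝ≥0} (hst : s ≤ t)
    (z : EuclideanSpace ℝ (Fin d)) :
    charFun (P.map fun ω ↦ compoundSum N Z t ω - compoundSum N Z s ω) z
      = Complex.exp (((ρ Set.univ).toNNReal * (t - s) : ℝ≥0)
        * (charFun (P.map (Z 0)) z - 1)) := by
  have hm := measurable_compoundSum hV.poisson.measurable hV.measurable
  have hmono : Monotone ![s, t] := by
    intro i j hij
    fin_cases i <;> fin_cases j <;> simp_all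
  have := hV.integral_exp_increments_eq_prod hmono (fun _ : Fin 1 ↦ z)
  rw [charFun_apply, integral_map (by fun_prop) (by fun_prop)]
  simpa using this

lemma IsCompoundPoissonData.hasIndepIncrements [IsProbabilityMeasure P]
    (hV : IsCompoundPoissonData N Z ρ P) : HasIndepIncrements (compoundSum N Z) P := by
  intro n t ht
  have hm := measurable_compoundSum hV.poisson.measurable hV.measurable
  rw [iIndepFun_iff_charFun_pi (fun i ↦ by fun_prop)]
  intro z
  simp_rw [fun i : Fin n ↦ hV.charFun_increment (ht i.castSucc_lt_succ.le)]
  rw [← hV.integral_exp_increments_eq_prod ht, charFun_apply,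
    integral_map (by fun_prop) (by fun_prop)]
  refine integral_congr_ae (ae_of_all _ fun ω ↦ ?_)
  simp only [PiLp.inner_apply, ← Complex.exp_sum, Complex.ofReal_sum, Finset.sum_mul]

/-- By `charFun_increment` the characteristic function depends only on the length of the time
interval. -/
lemma IsCompoundPoissonData.map_increment [IsProbabilityMeasure P]
    (hV : IsCompoundPoissonData N Z ρ P) (s t : ℝ≥0) :
    P.map (fun ω ↦ compoundSum N Z (s + t) ω - compoundSum N Z s ω)
      = P.map (fun ω ↦ compoundSum N Z t ω - compoundSum N Z 0 ω) := by
  have hm := measurable_compoundSum hV.poisson.measurable hV.measurable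
  have h1 : IsProbabilityMeasure
      (P.map (fun ω ↦ compoundSum N Z (s + t) ω - compoundSum N Z s ω)) :=
    Measure.isProbabilityMeasure_map (by fun_prop)
  have h2 : IsProbabilityMeasure
      (P.map (fun ω ↦ compoundSum N Z t ω - compoundSum N Z 0 ω)) :=
    Measure.isProbabilityMeasure_map (by fun_prop)
  refine Measure.ext_of_charFun (funext fun z ↦ ?_)
  rw [hV.charFun_increment le_self_add, hV.charFun_increment (zero_le)]
  simp

lemma IsCompoundPoissonData.compoundSum_zero (hV : IsCompoundPoissonData N Z ρ P) :
    ∀ᵐ ω ∂P, compoundSum N Z 0 ω = 0 := by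
  filter_upwards [hV.poisson.start] with ω hω
  simp [compoundSum, hω]

/-- The characteristic function of a compound Poisson variable in terms of its jump measure. -/
lemma IsCompoundPoissonData.charFun_one [IsProbabilityMeasure P] [IsFiniteMeasure ρ]
    (hV : IsCompoundPoissonData N Z ρ P) (z : EuclideanSpace ℝ (Fin d)) :
    charFun (P.map (compoundSum N Z 1)) z
      = Complex.exp (∫ x, (Complex.exp (Complex.I * ((inner ℝ z x : ℝ) : ℂ)) - 1) ∂ρ) := by
  have hm := measurable_compoundSum hV.poisson.measurable hV.measurable
  have h0 : P.map (compoundSum N Z 1)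
      = P.map (fun ω ↦ compoundSum N Z 1 ω - compoundSum N Z 0 ω) := by
    refine Measure.map_congr ?_
    filter_upwards [hV.compoundSum_zero] with ω hω
    rw [hω, sub_zero]
  rw [h0, hV.charFun_increment zero_le_one]
  congr 1
  have hint : Integrable (fun x ↦ Complex.exp (Complex.I * ((inner ℝ z x : ℝ) : ℂ))) ρ := by
    refine Integrable.of_bound (by fun_prop) 1 (ae_of_all _ fun x ↦ ?_)
    rw [mul_comm, Complex.norm_exp_ofReal_mul_I]
  rw [integral_sub hint (integrable_const _)]
  have hcf : ∫ x, Complex.exp (Complex.I * ((inner ℝ z x : ℝ) : ℂ)) ∂ρ = charFun ρ z := by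
    rw [charFun_apply]
    simp_rw [real_inner_comm z, mul_comm Complex.I]
  rw [hcf]
  -- If `η = 0` the law of `Z 0` is unknown, but it enters multiplied by the intensity `0`.
  by_cases hρ : ρ Set.univ = 0
  · rw [Measure.measure_univ_eq_zero.1 hρ]
    simp
  · rw [hV.law hρ 0, charFun_apply, integral_smul_measure, ← charFun_apply]
    have hne : ((ρ Set.univ).toReal : ℂ) ≠ 0 := by
      exact_mod_cast (ENNReal.toReal_pos hρ (measure_ne_top _ _)).ne'
    have hcoe : ((((ρ Set.univ).toNNReal * (1 - 0) : ℝ≥0) : ℝ) : ℂ) = (ρ Set.univ).toReal := by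
      simp [ENNReal.toReal]
    simp only [integral_const, Measure.real, ENNReal.toReal_inv, Complex.real_smul, mul_one,
      Complex.ofReal_inv]
    rw [hcoe]
    field_simp

end compoundPoisson

/-! ### The first jump time -/

lemma firstJumpTime_le {Ω : Type*} {N : ℝ≥0 → Ω → ℕ} {ω : Ω} {t : ℝ≥0} (h : 0 < N t ω) :
    firstJumpTime N ω ≤ t :=
  sInf_le ⟨t, h, rfl⟩

lemma eq_zero_of_lt_firstJumpTime {Ω : Type*} {N : ℝ≥0 → Ω → ℕ} {ω : Ω} {t : ℝ≥0}
    (h : (t : ℝ≥0∞) < firstJumpTime N ω) :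
    N t ω = 0 := by
  by_contra hne
  exact absurd (firstJumpTime_le (Nat.pos_of_ne_zero hne)) (not_le.2 h)

/-- Right-continuity keeps the count at `0` up to some `u > t`; by monotonicity every time with a
positive count is at least `u`. This makes the inequality strict. -/
lemma lt_firstJumpTime_of_eq_zero {Ω : Type*} {N : ℝ≥0 → Ω → ℕ} {ω : Ω} {t : ℝ≥0}
    (hmono : Monotone fun t ↦ N t ω)
    (hcont : ContinuousWithinAt (fun s ↦ N s ω) (Set.Ici t) t) (h : N t ω = 0) :
    (t : ℝ≥0∞) < firstJumpTime N ω := by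
  have hev : ∀ᶠ s in 𝓝[>] t, N s ω = 0 := by
    have : Tendsto (fun s ↦ N s ω) (𝓝[≥] t) (pure 0) := by
      rw [← nhds_discrete, ← h]
      exact hcont
    exact (tendsto_pure.1 this).filter_mono (nhdsWithin_mono _ Set.Ioi_subset_Ici_self)
  obtain ⟨u, hu0, htu⟩ := (hev.and self_mem_nhdsWithin).exists
  refine lt_of_lt_of_le (ENNReal.coe_lt_coe.2 htu) (le_sInf ?_)
  rintro _ ⟨s, hs, rfl⟩
  rw [ENNReal.coe_le_coe]
  by_contra! hsu
  have : N s ω ≤ N u ω := hmono hsu.le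
  omega

/-! ### Probabilities and path properties of the Poisson process -/

section poissonPaths

variable {Ω : Type*} [MeasurableSpace Ω] {P : Measure Ω} {N : ℝ≥0 → Ω → ℕ} {r : ℝ≥0}

lemma IsPoissonProcess.measure_eq (hN : IsPoissonProcess N r P) {s t : ℝ≥0} (hst : s ≤ t) :
    P {ω | N t ω = N s ω} = ENNReal.ofReal (Real.exp (-(r * (t - s : ℝ≥0) : ℝ))) := by
  have hNm := hN.measurable
  have hlaw := hN.law s (t - s)
  rw [add_tsub_cancel_of_le hst] at hlaw
  have h1 : {ω | N t ω = N s ω} = (fun ω ↦ (N t ω : ℤ) - (N s ω : ℤ)) ⁻¹' {0} := by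
    ext ω
    simp [sub_eq_zero]
  have h2 : (fun n : ℕ ↦ (n : ℤ)) ⁻¹' {0} = {0} := by
    ext n
    simp
  rw [h1, ← Measure.map_apply (by fun_prop) (measurableSet_singleton _), hlaw,
    Measure.map_apply .of_discrete (measurableSet_singleton _), h2, poissonMeasure_singleton]
  simp

lemma IsPoissonProcess.measure_eq_zero (hN : IsPoissonProcess N r P) (t : ℝ≥0) :
    P {ω | N t ω = 0} = ENNReal.ofReal (Real.exp (-(r * t : ℝ))) := by
  have h := hN.measure_eq (zero_le : 0 ≤ t)
  rw [tsub_zero] at h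
  rw [← h]
  refine measure_congr (Filter.eventuallyEq_set.2 ?_)
  filter_upwards [hN.start] with ω hω
  simp [hω]

lemma IsPoissonProcess.measure_ne [IsProbabilityMeasure P] (hN : IsPoissonProcess N r P)
    (s t : ℝ≥0) :
    P {ω | N s ω ≠ N t ω} = ENNReal.ofReal (1 - Real.exp (-(r * dist s t))) := by
  wlog hst : s ≤ t generalizing s t
  · rw [dist_comm, ← this t s (le_of_not_ge hst)]
    simp_rw [ne_comm]
  have hNm := hN.measurable
  have hm : MeasurableSet {ω | N t ω = N s ω} := measurableSet_eq_fun (hNm t) (hNm s)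
  have hc : {ω | N s ω ≠ N t ω} = {ω | N t ω = N s ω}ᶜ := by
    ext ω
    simp [eq_comm]
  have hd : dist s t = (t - s : ℝ≥0) := by
    rw [dist_comm, NNReal.dist_eq, ← NNReal.coe_sub hst, abs_of_nonneg (NNReal.coe_nonneg _)]
  rw [hc, prob_compl_eq_one_sub hm, hN.measure_eq hst, hd,
    ENNReal.ofReal_sub _ (Real.exp_pos _).le, ENNReal.ofReal_one]

lemma IsPoissonProcess.tendsto_measure_ne [IsProbabilityMeasure P] (hN : IsPoissonProcess N r P)
    (t : ℝ≥0) : Tendsto (fun s ↦ P {ω | N s ω ≠ N t ω}) (𝓝 t) (𝓝 0) := by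
  simp_rw [hN.measure_ne]
  have : Continuous fun s : ℝ≥0 ↦ ENNReal.ofReal (1 - Real.exp (-(r * dist s t))) :=
    ENNReal.continuous_ofReal.comp (by fun_prop)
  simpa using this.tendsto t

lemma IsPoissonProcess.measure_lt_firstJumpTime (hN : IsPoissonProcess N r P) (t : ℝ≥0) :
    P {ω | (t : ℝ≥0∞) < firstJumpTime N ω} = ENNReal.ofReal (Real.exp (-(r * t : ℝ))) := by
  rw [← hN.measure_eq_zero]
  refine measure_congr (Filter.eventuallyEq_set.2 ?_)
  filter_upwards [hN.path] with ω hω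
  exact ⟨eq_zero_of_lt_firstJumpTime, lt_firstJumpTime_of_eq_zero hω.1 (hω.2 t)⟩

lemma IsPoissonProcess.aemeasurable_firstJumpTime (hN : IsPoissonProcess N r P) :
    AEMeasurable (firstJumpTime N) P := by
  have hNm := hN.measurable
  -- By monotonicity a positive count persists, so an infimum over rational times suffices; negative
  -- rationals are sent to time `0`.
  refine ⟨fun ω ↦ ⨅ q : ℚ, if 0 < N (Real.toNNReal q) ω then (Real.toNNReal q : ℝ≥0∞) else ∞,
    ?_, ?_⟩
  · refine Measurable.iInf fun q ↦ Measurable.ite ?_ measurable_const measurable_const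
    exact measurableSet_lt measurable_const (hNm _)
  · filter_upwards [hN.path] with ω hω
    refine le_antisymm (le_iInf fun q ↦ ?_) (le_sInf ?_)
    · split_ifs with h
      · exact firstJumpTime_le h
      · exact le_top
    · rintro _ ⟨s, hs, rfl⟩
      refine le_of_forall_gt fun u hu ↦ ?_
      obtain ⟨q, -, hsq, hqu⟩ := ENNReal.lt_iff_exists_rat_btwn.1 hu
      refine lt_of_le_of_lt (iInf_le _ q) ?_
      have hq : 0 < N (Real.toNNReal q) ω :=
        hs.trans_le (hω.1 (ENNReal.coe_lt_coe.1 hsq).le)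
      rwa [if_pos hq]

/-- A bounded monotone `ℕ`-valued function is eventually constant at the left of each point. -/
lemma Monotone.exists_tendsto_nhdsLT_nat {f : ℝ≥0 → ℕ} (hf : Monotone f) (t : ℝ≥0) :
    ∃ n, Tendsto f (𝓝[<] t) (pure n) := by
  by_cases ht : t = 0
  · refine ⟨0, ?_⟩
    have : Set.Iio t = ∅ := by
      ext s
      simp [ht]
    rw [this, nhdsWithin_empty]
    exact tendsto_bot
  -- The values to the left of `t` are bounded by `f t`, so their maximum is attained at some `s <
  -- t`, and `f` is constant on `(s, t)`.
  have hfin : (f '' Set.Iio t).Finite :=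
    (Set.finite_Iic (f t)).subset (by rintro _ ⟨s, hs, rfl⟩; exact hf (le_of_lt hs))
  have hne : (f '' Set.Iio t).Nonempty := ⟨_, 0, pos_iff_ne_zero.2 ht, rfl⟩
  obtain ⟨_, ⟨s, hs, rfl⟩, hmax⟩ := Set.exists_max_image _ id hfin hne
  refine ⟨f s, tendsto_pure.2 ?_⟩
  filter_upwards [Ioo_mem_nhdsLT hs] with u hu
  exact le_antisymm (hmax _ ⟨u, hu.2, rfl⟩) (hf hu.1.le)

/-- Every map out of discrete `ℕ` is continuous. With `F` the partial sums of the jumps at a fixed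
`ω`, this gives the paths of `V`. -/
lemma isCadlagPath_comp_nat {E : Type*} [TopologicalSpace E] {f : ℝ≥0 → ℕ} (hf : Monotone f)
    (hc : ∀ t, ContinuousWithinAt f (Set.Ici t) t) (F : ℕ → E) :
    IsCadlagPath fun t ↦ F (f t) := by
  refine fun t ↦ ⟨(continuous_of_discreteTopology (f := F)).continuousAt.comp_continuousWithinAt
    (hc t), ?_⟩
  obtain ⟨n, hn⟩ := hf.exists_tendsto_nhdsLT_nat t
  refine ⟨F n, ?_⟩
  exact ((tendsto_pure_nhds F n).comp hn)

end poissonPaths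

lemma IsCadlagPath.add {E : Type*} [TopologicalSpace E] [Add E] [ContinuousAdd E]
    {f g : ℝ≥0 → E} (hf : IsCadlagPath f) (hg : IsCadlagPath g) :
    IsCadlagPath fun t ↦ f t + g t := by
  intro t
  obtain ⟨hf1, l, hl⟩ := hf t
  obtain ⟨hg1, k, hk⟩ := hg t
  exact ⟨hf1.add hg1, l + k, hl.add hk⟩

/-! ### Splitting the Lévy–Khintchine exponent -/

section tempering

variable {d : ℕ} {L : Measure (EuclideanSpace ℝ (Fin d))} {h g : EuclideanSpace ℝ (Fin d) → ℝ}

lemma isFiniteMeasure_removedMeasure (hA1 : ∀ x, 0 ≤ g x ∧ g x ≤ 1)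
    (hA2 : ∫⁻ x, ENNReal.ofReal (max ‖h x • x‖ 1 * (1 - g x)) ∂L < ∞) :
    IsFiniteMeasure (removedMeasure L g) := by
  refine ⟨?_⟩
  rw [removedMeasure, withDensity_apply _ MeasurableSet.univ, Measure.restrict_univ]
  refine lt_of_le_of_lt (lintegral_mono fun x ↦ ENNReal.ofReal_le_ofReal ?_) hA2
  have := hA1 x
  exact le_mul_of_one_le_left (by linarith) (le_max_right _ _)

lemma integral_temperedMeasure (hg : Measurable g) (hg0 : ∀ x, 0 ≤ g x) {E : Type*}
    [NormedAddCommGroup E] [NormedSpace ℝ E] (f : EuclideanSpace ℝ (Fin d) → E) :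
    ∫ x, f x ∂(temperedMeasure L g) = ∫ x, g x • f x ∂L := by
  rw [temperedMeasure, integral_withDensity_eq_integral_toReal_smul (by fun_prop)
    (ae_of_all _ fun _ ↦ ENNReal.ofReal_lt_top)]
  simp_rw [ENNReal.toReal_ofReal (hg0 _)]

lemma integrable_temperedMeasure_iff (hg : Measurable g) (hg0 : ∀ x, 0 ≤ g x) {E : Type*}
    [NormedAddCommGroup E] [NormedSpace ℝ E] {f : EuclideanSpace ℝ (Fin d) → E} :
    Integrable f (temperedMeasure L g) ↔ Integrable (fun x ↦ g x • f x) L := by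
  rw [temperedMeasure, integrable_withDensity_iff_integrable_smul' (by fun_prop)
    (ae_of_all _ fun _ ↦ ENNReal.ofReal_lt_top)]
  simp_rw [ENNReal.toReal_ofReal (hg0 _)]

/-- Removing the jumps `(1 - g) L` from the Lévy measure and their compensator from the shift
splits off the exponent of a compound Poisson distribution. -/
lemma levyExponent_eq_tempered_add {A : Matrix (Fin d) (Fin d) ℝ} {b : EuclideanSpace ℝ (Fin d)}
    (hh : Measurable h) (hg : Measurable g) (hA1 : ∀ x, 0 ≤ g x ∧ g x ≤ 1)
    (hA2 : ∫⁻ x, ENNReal.ofReal (max ‖h x • x‖ 1 * (1 - g x)) ∂L < ∞)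
    (z : EuclideanSpace ℝ (Fin d)) (hint : Integrable (levyIntegrand h z) L) :
    levyExponent A L b h z
      = levyExponent A (temperedMeasure L g) (temperedShift L b h g) h z
        + ∫ x, (Complex.exp (Complex.I * ((inner ℝ z x : ℝ) : ℂ)) - 1) ∂(removedMeasure L g) := by
  have hg0 : ∀ x, 0 ≤ g x := fun x ↦ (hA1 x).1
  have hg1 : ∀ x, 0 ≤ 1 - g x := fun x ↦ sub_nonneg.2 (hA1 x).2
  have hg' : Measurable fun x ↦ 1 - g x := by fun_prop
  have hfin := isFiniteMeasure_removedMeasure hA1 hA2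
  have hrem : removedMeasure L g = temperedMeasure L fun x ↦ 1 - g x := rfl
  -- Here the term `‖h x • x‖` in the maximum of (A2) is used; the term `1` gave finiteness of `ρ`.
  have hdrift : Integrable (fun x ↦ (h x * (1 - g x)) • x) L := by
    refine ⟨by fun_prop, ?_⟩
    refine lt_of_le_of_lt (lintegral_mono fun x ↦ ?_) hA2
    rw [← ofReal_norm]
    refine ENNReal.ofReal_le_ofReal ?_
    beta_reduce
    rw [mul_comm (h x), mul_smul, norm_smul, Real.norm_of_nonneg (hg1 x), mul_comm]
    exact mul_le_mul_of_nonneg_right (le_max_left _ _) (hg1 x)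
  have hexp : Integrable (fun x ↦ Complex.exp (Complex.I * ((inner ℝ z x : ℝ) : ℂ)) - 1)
      (removedMeasure L g) := by
    refine Integrable.sub (Integrable.of_bound (by fun_prop) 1 (ae_of_all _ fun x ↦ ?_))
      (integrable_const _)
    rw [mul_comm, Complex.norm_exp_ofReal_mul_I]
  have hexp' := hexp
  rw [hrem, integrable_temperedMeasure_iff hg' hg1] at hexp'
  have hI : Measurable (levyIntegrand h z) := by
    unfold levyIntegrand
    fun_prop
  have hgI : Integrable (fun x ↦ g x • levyIntegrand h z x) L := by
    refine hint.mono (by fun_prop) (ae_of_all _ fun x ↦ ?_)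
    rw [norm_smul, Real.norm_of_nonneg (hg0 x)]
    exact mul_le_of_le_one_left (norm_nonneg _) (hA1 x).2
  have hinner : Integrable (fun x ↦ ((inner ℝ z ((h x * (1 - g x)) • x) : ℝ) : ℂ)) L :=
    (hdrift.const_inner z).ofReal
  have hsplit : ∫ x, levyIntegrand h z x ∂L
      = ∫ x, g x • levyIntegrand h z x ∂L
        + (∫ x, (1 - g x) • (Complex.exp (Complex.I * ((inner ℝ z x : ℝ) : ℂ)) - 1) ∂L
          - Complex.I * ∫ x, ((inner ℝ z ((h x * (1 - g x)) • x) : ℝ) : ℂ) ∂L) := by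
    rw [← integral_const_mul, ← integral_sub hexp' (hinner.const_mul _)]
    refine Eq.trans ?_ (integral_add hgI (hexp'.sub (hinner.const_mul _)))
    refine integral_congr_ae (ae_of_all _ fun x ↦ ?_)
    simp only [levyIntegrand, inner_smul_right, Complex.real_smul]
    push_cast
    ring
  have hshift : ((inner ℝ (temperedShift L b h g) z : ℝ) : ℂ)
      = ((inner ℝ b z : ℝ) : ℂ) - ∫ x, ((inner ℝ z ((h x * (1 - g x)) • x) : ℝ) : ℂ) ∂L := by
    rw [temperedShift, inner_sub_left, integral_complex_ofReal, integral_inner hdrift z,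
      real_inner_comm z, real_inner_comm z, Complex.ofReal_sub]
  rw [levyExponent, levyExponent, hshift, hsplit, integral_temperedMeasure hg hg0, hrem,
    integral_temperedMeasure hg' hg1]
  ring

end tempering

/-! ### Adding the compound Poisson process -/

section superposition

variable {d : ℕ} {Ω : Type*} [MeasurableSpace Ω] {P : Measure Ω}
  {N : ℝ≥0 → Ω → ℕ} {Z : ℕ → Ω → EuclideanSpace ℝ (Fin d)}
  {ρ : Measure (EuclideanSpace ℝ (Fin d))} {Y : ℝ≥0 → Ω → EuclideanSpace ℝ (Fin d)}

/-- Adding an independent compound Poisson process to a Lévy process gives a Lévy process. -/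
lemma IsLevyProcessInLaw.add_compoundSum [IsProbabilityMeasure P] (hY : IsLevyProcessInLaw Y P)
    (hV : IsCompoundPoissonData N Z ρ P)
    (hYV : IndepFun (fun ω t ↦ Y t ω) (fun ω t ↦ compoundSum N Z t ω) P) :
    IsLevyProcessInLaw (fun t ω ↦ Y t ω + compoundSum N Z t ω) P where
  measurable t :=
    (hY.measurable t).add (measurable_compoundSum hV.poisson.measurable hV.measurable t)
  start := by
    filter_upwards [hY.start, hV.compoundSum_zero] with ω h1 h2
    rw [h1, h2, add_zero]
  indep := hasIndepIncrements_add hY.measurable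
    (measurable_compoundSum hV.poisson.measurable hV.measurable) hY.indep hV.hasIndepIncrements hYV
  stationary s t := by
    have hm := measurable_compoundSum hV.poisson.measurable hV.measurable
    have hYm := hY.measurable
    have hmap : ∀ a b : ℝ≥0, P.map (fun ω ↦ (Y a ω + compoundSum N Z a ω)
        - (Y b ω + compoundSum N Z b ω))
        = (P.map fun ω ↦ Y a ω - Y b ω).conv
          (P.map fun ω ↦ compoundSum N Z a ω - compoundSum N Z b ω) := by
      intro a b
      have hab : IndepFun (fun ω ↦ Y a ω - Y b ω)
          (fun ω ↦ compoundSum N Z a ω - compoundSum N Z b ω) P :=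
        hYV.comp (φ := fun f : ℝ≥0 → EuclideanSpace ℝ (Fin d) ↦ f a - f b)
          (ψ := fun f : ℝ≥0 → EuclideanSpace ℝ (Fin d) ↦ f a - f b) (by fun_prop) (by fun_prop)
      rw [← hab.map_add_eq_map_conv_map₀ (by fun_prop) (by fun_prop)]
      congr 1
      funext ω
      exact add_sub_add_comm _ _ _ _
    rw [hmap, hmap, hY.stationary, hV.map_increment]
  stochCont t := by
    intro ε hε
    -- No bound on jump sizes is needed: unless `N` changes between `s` and `t`, the increment of
    -- the sum is that of `Y`.
    have hlim := (hY.stochCont t ε hε).add (hV.poisson.tendsto_measure_ne t)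
    rw [add_zero] at hlim
    refine tendsto_of_tendsto_of_tendsto_of_le_of_le tendsto_const_nhds hlim
      (fun _ ↦ zero_le) fun s ↦ ?_
    refine (measure_mono fun ω hω ↦ ?_).trans (measure_union_le _ _)
    by_cases hN : N s ω = N t ω
    · left
      have hVst : compoundSum N Z s ω = compoundSum N Z t ω := by
        rw [compoundSum, compoundSum, hN]
      simpa only [Set.mem_ofPred_eq, hVst, edist_add_right] using hω
    · exact Or.inr hN

lemma IsLevyProcess.add_compoundSum [IsProbabilityMeasure P] (hY : IsLevyProcess Y P)
    (hV : IsCompoundPoissonData N Z ρ P)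
    (hYV : IndepFun (fun ω t ↦ Y t ω) (fun ω t ↦ compoundSum N Z t ω) P) :
    IsLevyProcess (fun t ω ↦ Y t ω + compoundSum N Z t ω) P where
  toIsLevyProcessInLaw := hY.toIsLevyProcessInLaw.add_compoundSum hV hYV
  cadlag := by
    filter_upwards [hY.cadlag, hV.poisson.path] with ω h1 h2
    exact h1.add (isCadlagPath_comp_nat h2.1 h2.2 fun n ↦ ∑ i ∈ Finset.range n, Z i ω)

/-- On the event that no jump has occurred, which is independent of `Y`, the two processes agree. -/
lemma IsCompoundPoissonData.measure_preimage_le (hV : IsCompoundPoissonData N Z ρ P)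
    (hYV : IndepFun (fun ω t ↦ Y t ω) (fun ω t ↦ compoundSum N Z t ω) P)
    {B : Set (EuclideanSpace ℝ (Fin d))} (hB : MeasurableSet B) (t : ℝ≥0) :
    P (Y t ⁻¹' B) ≤ ENNReal.ofReal (Real.exp (t * (ρ Set.univ).toReal))
      * P ((fun ω ↦ Y t ω + compoundSum N Z t ω) ⁻¹' B) := by
  have hind : IndepFun (Y t) (compoundSum N Z t) P :=
    hYV.comp (φ := fun f : ℝ≥0 → EuclideanSpace ℝ (Fin d) ↦ f t)
      (ψ := fun f : ℝ≥0 → EuclideanSpace ℝ (Fin d) ↦ f t) (by fun_prop) (by fun_prop)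
  -- Independence of `Y` is assumed from `V`, not from `N`, so the event `N t = 0` is enlarged to `V
  -- t = 0`; a lower bound is enough.
  have hzero : ENNReal.ofReal (Real.exp (-(t * (ρ Set.univ).toReal)))
      ≤ P (compoundSum N Z t ⁻¹' {0}) := by
    have := hV.poisson.measure_eq_zero t
    rw [mul_comm] at this
    refine this.symm.le.trans (measure_mono fun ω hω ↦ ?_)
    rw [Set.mem_ofPred_eq] at hω
    simp [compoundSum, hω]
  have hinter : P (Y t ⁻¹' B) * P (compoundSum N Z t ⁻¹' {0})
      ≤ P ((fun ω ↦ Y t ω + compoundSum N Z t ω) ⁻¹' B) := by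
    rw [← hind.measure_inter_preimage_eq_mul _ _ hB (measurableSet_singleton _)]
    refine measure_mono fun ω hω ↦ ?_
    have h0 : compoundSum N Z t ω = 0 := hω.2
    simpa [h0] using hω.1
  have hone : ENNReal.ofReal (Real.exp (t * (ρ Set.univ).toReal))
      * ENNReal.ofReal (Real.exp (-(t * (ρ Set.univ).toReal))) = 1 := by
    rw [← ENNReal.ofReal_mul (Real.exp_pos _).le, ← Real.exp_add, add_neg_cancel, Real.exp_zero,
      ENNReal.ofReal_one]
  calc
    P (Y t ⁻¹' B) = ENNReal.ofReal (Real.exp (t * (ρ Set.univ).toReal))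
        * (P (Y t ⁻¹' B) * ENNReal.ofReal (Real.exp (-(t * (ρ Set.univ).toReal)))) := by
      rw [mul_left_comm, hone, mul_one]
    _ ≤ _ := by
      gcongr
      exact le_trans (by gcongr) hinter

end superposition

theorem theorem1 {d : ℕ} {Ω : Type*} [MeasurableSpace Ω] (P : Measure Ω) [IsProbabilityMeasure P]
    (A : Matrix (Fin d) (Fin d) ℝ) (L : Measure (EuclideanSpace ℝ (Fin d)))
    (b : EuclideanSpace ℝ (Fin d)) (h g : EuclideanSpace ℝ (Fin d) → ℝ)
    (μ μt : Measure (EuclideanSpace ℝ (Fin d)))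
    (hμ : IsID μ A L b h)
    (hg : Measurable g)
    (hA1 : ∀ x, 0 ≤ g x ∧ g x ≤ 1)
    (hA2 : ∫⁻ x, ENNReal.ofReal (max ‖h x • x‖ 1 * (1 - g x)) ∂L < ∞)
    (hμt : IsID μt A (temperedMeasure L g) (temperedShift L b h g) h)
    (N : ℝ≥0 → Ω → ℕ) (Z : ℕ → Ω → EuclideanSpace ℝ (Fin d))
    (hV : IsCompoundPoissonData N Z (removedMeasure L g) P)
    (Xt : ℝ≥0 → Ω → EuclideanSpace ℝ (Fin d))
    (hXt : IsLevyProcessInLaw Xt P)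
    (hXt1 : HasLaw (Xt 1) μt P)
    (hindep : IndepFun (fun ω t ↦ Xt t ω) (fun ω t ↦ compoundSum N Z t ω) P)
    (X : ℝ≥0 → Ω → EuclideanSpace ℝ (Fin d))
    (hX : ∀ t ω, X t ω = Xt t ω + compoundSum N Z t ω) :
    -- `η` is finite, and `T` is exponentially distributed with rate `η`
    removedMeasure L g Set.univ < ∞ ∧
    AEMeasurable (firstJumpTime N) P ∧
    (∀ t : ℝ≥0, P {ω | (t : ℝ≥0∞) < firstJumpTime N ω}
      = ENNReal.ofReal (Real.exp (-(t : ℝ) * (removedMeasure L g Set.univ).toReal))) ∧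
    -- 1. `X` is a Lévy process with `X 1 ∼ μ`
    IsLevyProcessInLaw X P ∧ (IsLevyProcess Xt P → IsLevyProcess X P) ∧ HasLaw (X 1) μ P ∧
    -- 2. `X` and `Xt` agree before `T`
    (∀ ω, ∀ t : ℝ≥0, (t : ℝ≥0∞) < firstJumpTime N ω → X t ω = Xt t ω) ∧
    -- 3. comparison of the one-dimensional distributions
    (∀ B : Set (EuclideanSpace ℝ (Fin d)), MeasurableSet B → ∀ t : ℝ≥0,
      P (Xt t ⁻¹' B)
        ≤ ENNReal.ofReal (Real.exp ((t : ℝ) * (removedMeasure L g Set.univ).toReal))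
          * P (X t ⁻¹' B)) := by
  have hfin := isFiniteMeasure_removedMeasure hA1 hA2
  have hm := measurable_compoundSum hV.poisson.measurable hV.measurable
  have hXtm := hXt.measurable
  obtain rfl : X = fun t ω ↦ Xt t ω + compoundSum N Z t ω := by
    funext t ω
    exact hX t ω
  have hlevy := hXt.add_compoundSum hV hindep
  refine ⟨measure_lt_top _ _, hV.poisson.aemeasurable_firstJumpTime, fun t ↦ ?_, hlevy,
    fun h ↦ h.add_compoundSum hV hindep, ⟨(hlevy.measurable 1).aemeasurable, ?_⟩,
    fun ω t ht ↦ ?_, fun B hB t ↦ hV.measure_preimage_le hindep hB t⟩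
  · rw [hV.poisson.measure_lt_firstJumpTime, neg_mul, mul_comm (t : ℝ)]
    rfl
  · have hμ1 := hμ.isProbabilityMeasure
    have hX1 : IsProbabilityMeasure (P.map fun ω ↦ Xt 1 ω + compoundSum N Z 1 ω) :=
      Measure.isProbabilityMeasure_map (by fun_prop)
    have hind : IndepFun (Xt 1) (compoundSum N Z 1) P :=
      hindep.comp (φ := fun f : ℝ≥0 → EuclideanSpace ℝ (Fin d) ↦ f 1)
        (ψ := fun f : ℝ≥0 → EuclideanSpace ℝ (Fin d) ↦ f 1) (by fun_prop) (by fun_prop)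
    refine Measure.ext_of_charFun (funext fun z ↦ ?_)
    rw [hind.charFun_map_fun_add_eq_mul (by fun_prop) (by fun_prop), Pi.mul_apply, hXt1.map_eq,
      hμt.charFun_eq, hV.charFun_one, ← Complex.exp_add, hμ.charFun_eq,
      levyExponent_eq_tempered_add hμ.measurable_h hg hA1 hA2 z (hμ.integrable z)]
  · simp [compoundSum, eq_zero_of_lt_firstJumpTime ht]
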